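/- Let $M$ be a finitely generated monoid and, for $n\ge 0$, let $F_n$ be the free group of rank $n$. Fix an arbitrary finite generating set $B$ of the monoid $M$ and, for each $n\ge 0$, an arbitrary finite monoid generating set $A_n$ of $F_n\times M$; elements of these monoids are given as words over the respective generating sets. Then the following are equivalent: (i) the rational subset problem is decidable for the direct product $F_2\times M$; (ii) the rational subset problem is decidable for the direct product $F_n\times M$ for every $n\ge 0$; (iii) membership is uniformly decidable for context-free subsets of $M$, encoded as context-free grammars over $B$. Here the rational subset problem for a monoid $N$ with a finite generating set $A$ is decidable if there is an algorithm which, given a finite automaton $P$ with edges labelled by elements of $N$ (written as words over $A$) and a word $w$ over $A$, decides whether the element of $N$ represented by $w$ is the label of a path in $P$ from the initial vertex to some terminal vertex (the label of a path being the product of the labels of its edges). Condition (iii) means that there is an algorithm which, given a context-free grammar $\Gamma$ with terminal alphabet $B$ and a word $w$ over $B$, decides whether the element of $M$ represented by $w$ is also represented by some word in the language generated by $\Gamma$. -/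

import Mathlib

namespace RatCF

/-- A finite automaton with edge labels in `L`, presented by finite data. Vertices are named by
natural numbers; the (finite) vertex set consists of the numbers that occur in the data.
An edge `(p, x, q)` goes from `p` to `q` and has label `x`. -/
structure FinAutomaton (L : Type*) where
  start : ℕ
  terminals : List ℕ
  edges : List (ℕ × L × ℕ)

namespace FinAutomaton

/-- Apply a function to all edge labels. -/
def mapLabels {L L' : Type*} (f : L → L') (P : FinAutomaton L) : FinAutomaton L' where
  start := P.start
  terminals := P.terminals
  edges := P.edges.map fun e => (e.1, f e.2.1, e.2.2)

/-- `P.Path p m q`: some path from `p` to `q` in `P` has label `m`, the label of a path being the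
product of the labels of its edges in order. -/
inductive Path {M : Type*} [Monoid M] (P : FinAutomaton M) : ℕ → M → ℕ → Prop
  | nil (p : ℕ) : Path P p 1 p
  | cons {p q r : ℕ} {x y : M} : (p, x, q) ∈ P.edges → Path P q y r → Path P p (x * y) r

/-- The subset of `M` recognised by a finite automaton over `M`. -/
def recognised {M : Type*} [Monoid M] (P : FinAutomaton M) : Set M :=
  {m | ∃ t ∈ P.terminals, P.Path P.start m t}

/-- The finite data as a tuple, used to make automata inputs of algorithms. -/
def equivTuple (L : Type*) : FinAutomaton L ≃ ℕ × List ℕ × List (ℕ × L × ℕ) where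
  toFun P := (P.start, P.terminals, P.edges)
  invFun t := ⟨t.1, t.2.1, t.2.2⟩
  left_inv _ := rfl
  right_inv _ := rfl

instance {L : Type*} [Primcodable L] : Primcodable (FinAutomaton L) :=
  Primcodable.ofEquiv _ (equivTuple L)

end FinAutomaton

/-- A context-free grammar with terminal alphabet `T`, presented by finite data. Nonterminals are
named by natural numbers. In the right-hand side of a rule, `Sum.inl t` is the terminal `t` and
`Sum.inr n` is the nonterminal `n`. -/
structure GrammarCode (T : Type*) where
  start : ℕ
  rules : List (ℕ × List (T ⊕ ℕ))

namespace GrammarCode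

/-- The context-free grammar (in the sense of Mathlib) given by the finite data. -/
def toGrammar {T : Type*} [DecidableEq T] (G : GrammarCode T) : ContextFreeGrammar T where
  NT := ℕ
  initial := G.start
  rules := (G.rules.map fun r =>
    (⟨r.1, r.2.map (Sum.elim Symbol.terminal Symbol.nonterminal)⟩ :
      ContextFreeRule T ℕ)).toFinset

/-- The finite data as a tuple, used to make grammars inputs of algorithms. -/
def equivTuple (T : Type*) : GrammarCode T ≃ ℕ × List (ℕ × List (T ⊕ ℕ)) where
  toFun G := (G.start, G.rules)
  invFun t := ⟨t.1, t.2⟩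
  left_inv _ := rfl
  right_inv _ := rfl

instance {T : Type*} [Primcodable T] : Primcodable (GrammarCode T) :=
  Primcodable.ofEquiv _ (equivTuple T)

end GrammarCode

/-- The finite family `gen` generates the monoid `M`. -/
def Generates {M : Type*} [Monoid M] {k : ℕ} (gen : Fin k → M) : Prop :=
  Submonoid.closure (Set.range gen) = ⊤

/-- The element of `M` represented by a word over the generators. -/
def evalWord {M : Type*} [Monoid M] {k : ℕ} (gen : Fin k → M) (w : List (Fin k)) : M :=
  (w.map gen).prod

/-- The rational subset of `M` encoded by an automaton whose edge labels, elements of `M`, are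
written as words over the generators. -/
def rationalSubset {M : Type*} [Monoid M] {k : ℕ} (gen : Fin k → M)
    (P : FinAutomaton (List (Fin k))) : Set M :=
  (P.mapLabels (evalWord gen)).recognised

/-- The context-free subset of `M` encoded by a grammar over the generators: the set of elements
represented by the words of the language of the grammar. -/
def contextFreeSubset {M : Type*} [Monoid M] {k : ℕ} (gen : Fin k → M)
    (G : GrammarCode (Fin k)) : Set M :=
  evalWord gen '' {w | w ∈ G.toGrammar.language}

/-- Membership is uniformly decidable for the subsets `S c` of `M` encoded by `c : C`: there is an
algorithm which, given a code `c` and a word `w` over the generators, decides whether the element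
represented by `w` lies in `S c`. -/
def UniformlyDecidable {M : Type*} [Monoid M] {k : ℕ} (gen : Fin k → M)
    {C : Type} [Primcodable C] (S : C → Set M) : Prop :=
  ComputablePred fun p : C × List (Fin k) => evalWord gen p.2 ∈ S p.1

/-- The rational subset problem for `M`, with respect to the generators `gen`, is decidable. -/
def RationalSubsetProblemDecidable {M : Type*} [Monoid M] {k : ℕ} (gen : Fin k → M) : Prop :=
  UniformlyDecidable gen (rationalSubset gen)

/-- Membership is uniformly decidable for context-free subsets of `M`, with respect to the
generators `gen`. -/
def ContextFreeMembershipDecidable {M : Type*} [Monoid M] {k : ℕ} (gen : Fin k → M) : Prop :=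
  UniformlyDecidable gen (contextFreeSubset gen)

end RatCF

/-!
The equivalence expresses that a free group of rank at least two is, as a memory, as good as a
pushdown stack: the rational subsets of `FreeGroup X × M`, cut down to those elements whose free
group component is trivial, are exactly the context-free subsets of `M`, and the translations in
both directions are computable.

The common core is `rel_of_path_one`. A path in an automaton with labels in `FreeGroup X × M` whose
free group component is trivial spells a word in the free generators and their inverses that reduces
to the empty word by cancelling neighbours. Hence every relation between vertices that contains the
moves not touching the free group, is closed under composition, and is closed under enclosing a step
between two edges with mutually inverse letters, contains all such paths.

* Rational subsets by means of context-free ones: given an automaton `P` and a word `w` with free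
  group component `g`, edges labelled `g⁻¹` are appended to the terminal vertices
  (`queryAutomaton`), edges are split into letters (`FinAutomaton.split`), and the closure
  properties above are read as the rules of a grammar with one nonterminal for each pair of vertices
  (`pathGrammar`). It generates the `M`-components of the paths with trivial free group component,
  so the question becomes a membership question for a context-free subset of `M`.
* Context-free subsets by means of rational ones: the leftmost derivations of a grammar are carried
  out by an automaton whose stack is the free group on the return addresses (`grammarAutomaton`).
  Unlike an honest stack, a free group also permits popping a symbol before pushing it. Since the
  return addresses are the suffixes of right-hand sides still to be processed, and steps with
  trivial stack effect only shorten the suffix, such a cancellation never occurs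
  (`derStep_of_path`). The countably many stack symbols are then placed inside the free group of
  rank two by `i ↦ a ^ i * b * a⁻¹ ^ i` (`freeGroupNatEmbed_injective`).
-/

namespace RatCF

open FinAutomaton

/-! ### Paths in automata -/

namespace FinAutomaton

theorem mem_mapLabels_edges {L L' : Type*} {f : L → L'} {P : FinAutomaton L} {p q : ℕ} {x : L'} :
    (p, x, q) ∈ (P.mapLabels f).edges ↔ ∃ y, (p, y, q) ∈ P.edges ∧ f y = x := by
  simp only [mapLabels, List.mem_map, Prod.mk.injEq]
  constructor
  · rintro ⟨⟨p', y, q'⟩, h, rfl, hx, rfl⟩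
    exact ⟨y, h, hx⟩
  · rintro ⟨y, h, hx⟩
    exact ⟨_, h, rfl, hx, rfl⟩

theorem mapLabels_mapLabels {L L' L'' : Type*} (f : L → L') (g : L' → L'') (P : FinAutomaton L) :
    (P.mapLabels f).mapLabels g = P.mapLabels (g ∘ f) := by
  simp [mapLabels]

section Path

variable {N : Type*} [Monoid N] {P : FinAutomaton N}

theorem Path.single {p q : ℕ} {x : N} (h : (p, x, q) ∈ P.edges) : P.Path p x q := by
  simpa using Path.cons h (Path.nil q)

theorem Path.trans {p q r : ℕ} {x y : N} (h : P.Path p x q) (h' : P.Path q y r) :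
    P.Path p (x * y) r := by
  induction h with
  | nil p => simpa using h'
  | cons he _ ih => simpa [mul_assoc] using Path.cons he (ih h')

/-- Relabelling along a monoid homomorphism replaces the labels of the paths by their images. -/
theorem path_mapLabels_hom {N' : Type*} [Monoid N'] (f : N →* N') {p q : ℕ} {y : N'} :
    (P.mapLabels f).Path p y q ↔ ∃ x, P.Path p x q ∧ f x = y := by
  constructor
  · intro h
    induction h with
    | nil p => exact ⟨1, .nil p, map_one f⟩
    | cons he _ ih =>
      obtain ⟨x, hx, rfl⟩ := ih
      obtain ⟨z, hz, rfl⟩ := mem_mapLabels_edges.1 he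
      exact ⟨z * x, .cons hz hx, map_mul f z x⟩
  · rintro ⟨x, hx, rfl⟩
    induction hx with
    | nil p => simpa using Path.nil p
    | cons he _ ih =>
      rw [map_mul]
      exact .cons (mem_mapLabels_edges.2 ⟨_, he, rfl⟩) ih

end Path

end FinAutomaton

/-! ### Paths whose free group component is trivial -/

section Cancellation

variable {X T M : Type*} [Monoid M]

/-- The element of `FreeGroup X × M` represented by a letter, which is either a generator of the
free group or its inverse, or a symbol standing for an element of `M`. -/
def evalLetter (X : Type*) (b : T → M) : (X × Bool) ⊕ T → FreeGroup X × M :=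
  Sum.elim (fun x => (FreeGroup.mk [x], 1)) fun t => (1, b t)

/-- The element of `FreeGroup X × M` represented by a letter or by the empty label. -/
def evalLabel (X : Type*) (b : T → M) (o : Option ((X × Bool) ⊕ T)) : FreeGroup X × M :=
  o.elim 1 (evalLetter X b)

/-- `LetterPath P N p L m q`: there is a route from `p` to `q` that alternates between steps of the
relation `N` and edges of `P` labelled by free group letters; the letters read form the list `L`,
and the elements of `M` contributed by the steps of `N` have product `m`. -/
inductive LetterPath (P : FinAutomaton (Option ((X × Bool) ⊕ T))) (N : ℕ → M → ℕ → Prop) :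
    ℕ → List (X × Bool) → M → ℕ → Prop
  | nil {p q : ℕ} {m : M} : N p m q → LetterPath P N p [] m q
  | cons {p p' q' q : ℕ} {x : X × Bool} {L : List (X × Bool)} {m m' : M} : N p m p' →
      (p', some (.inl x), q') ∈ P.edges → LetterPath P N q' L m' q →
      LetterPath P N p (x :: L) (m * m') q

variable {P : FinAutomaton (Option ((X × Bool) ⊕ T))} {N : ℕ → M → ℕ → Prop}

theorem LetterPath.prepend (trans : ∀ ⦃p q r m m'⦄, N p m q → N q m' r → N p (m * m') r)
    {p q r : ℕ} {L : List (X × Bool)} {m m' : M} (h : N p m q) (h' : LetterPath P N q L m' r) :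
    LetterPath P N p L (m * m') r := by
  cases h' with
  | nil h' => exact .nil (trans h h')
  | cons h₁ he h₂ =>
    rw [← mul_assoc]
    exact .cons (trans h h₁) he h₂

theorem LetterPath.step (trans : ∀ ⦃p q r m m'⦄, N p m q → N q m' r → N p (m * m') r)
    (cancel : ∀ ⦃p p' q' q x c m⦄, (p, some (.inl (x, c)), p') ∈ P.edges → N p' m q' →
      (q', some (.inl (x, !c)), q) ∈ P.edges → N p m q)
    {L L' : List (X × Bool)} (hL : FreeGroup.Red.Step L L') {p q : ℕ} {m : M}
    (h : LetterPath P N p L m q) : LetterPath P N p L' m q := by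
  obtain ⟨⟩ := hL
  rename_i L₁ L₂ x c
  induction L₁ generalizing p m with
  | nil =>
    obtain _ | ⟨h₁, he₁, h₂⟩ := h
    obtain _ | ⟨h₃, he₂, h₄⟩ := h₂
    exact (h₄.prepend trans (cancel he₁ h₃ he₂)).prepend trans h₁
  | cons y L₁ ih =>
    obtain _ | ⟨h₁, he₁, h₂⟩ := h
    exact .cons h₁ he₁ (ih h₂)

/-- A relation between vertices that is closed under the moves of the automaton not involving the
free group, and under enclosing a step between two edges with mutually inverse letters, contains
all paths with trivial free group component. The point is that a word representing `1` can be
reduced to the empty word by successive cancellations of neighbours, and each cancellation merges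
three consecutive parts of the path into one step of the relation. -/
theorem rel_of_path_one (b : T → M) (refl : ∀ p, N p 1 p)
    (trans : ∀ ⦃p q r m m'⦄, N p m q → N q m' r → N p (m * m') r)
    (silent : ∀ ⦃p q⦄, (p, none, q) ∈ P.edges → N p 1 q)
    (terminal : ∀ ⦃p q t⦄, (p, some (.inr t), q) ∈ P.edges → N p (b t) q)
    (cancel : ∀ ⦃p p' q' q x c m⦄, (p, some (.inl (x, c)), p') ∈ P.edges → N p' m q' →
      (q', some (.inl (x, !c)), q) ∈ P.edges → N p m q)
    {p q : ℕ} {m : M} (h : (P.mapLabels (evalLabel X b)).Path p (1, m) q) : N p m q := by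
  have key : ∀ {p q : ℕ} {g : FreeGroup X × M}, (P.mapLabels (evalLabel X b)).Path p g q →
      ∃ L, FreeGroup.mk L = g.1 ∧ LetterPath P N p L g.2 q := by
    intro p q g h
    induction h with
    | nil p => exact ⟨[], rfl, .nil (refl p)⟩
    | cons he _ ih =>
      obtain ⟨L, hL, hD⟩ := ih
      obtain ⟨o, ho, rfl⟩ := mem_mapLabels_edges.1 he
      rcases o with _ | x | t
      · exact ⟨L, by simpa [evalLabel] using hL, hD.prepend trans (silent ho)⟩
      · refine ⟨x :: L, ?_, .cons (refl _) ho hD⟩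
        simp [evalLabel, evalLetter, ← hL]
      · exact ⟨L, by simpa [evalLabel, evalLetter] using hL, hD.prepend trans (terminal ho)⟩
  obtain ⟨L, hL, hD⟩ := key h
  have hred : FreeGroup.Red L [] := by
    obtain ⟨L', h₁, h₂⟩ := FreeGroup.Red.exact.1 (hL.trans FreeGroup.one_eq_mk)
    rwa [FreeGroup.Red.nil_iff.1 h₂] at h₁
  have hnil : LetterPath P N p [] m q := by
    clear h hL
    induction hred using Relation.ReflTransGen.head_induction_on with
    | refl => exact hD
    | head hs _ ih => exact ih (hD.step trans cancel hs)
  cases hnil with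
  | nil h => exact h

end Cancellation

/-! ### Derivations in context-free grammars -/

namespace GrammarCode

variable {T : Type*}

/-- `G.Der α w`: the sentential form `α` derives the terminal word `w`. This is the big-step version
of the derivation relation of the grammar. -/
inductive Der (G : GrammarCode T) : List (T ⊕ ℕ) → List T → Prop
  | nil : Der G [] []
  | terminal (t : T) {α : List (T ⊕ ℕ)} {w : List T} : Der G α w → Der G (.inl t :: α) (t :: w)
  | nonterminal {n : ℕ} {β α : List (T ⊕ ℕ)} {v w : List T} : (n, β) ∈ G.rules →
      Der G β v → Der G α w → Der G (.inr n :: α) (v ++ w)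

variable {G : GrammarCode T}

theorem Der.append {α β : List (T ⊕ ℕ)} {v w : List T} (h : G.Der α v) (h' : G.Der β w) :
    G.Der (α ++ β) (v ++ w) := by
  induction h with
  | nil => exact h'
  | terminal t _ ih => exact .terminal t ih
  | nonterminal hr h₁ _ _ ih =>
    rw [List.append_assoc]
    exact .nonterminal hr h₁ ih

theorem Der.of_append {α β : List (T ⊕ ℕ)} {w : List T} (h : G.Der (α ++ β) w) :
    ∃ v v', w = v ++ v' ∧ G.Der α v ∧ G.Der β v' := by
  induction α generalizing w with
  | nil => exact ⟨[], w, rfl, .nil, h⟩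
  | cons s α ih =>
    cases h with
    | terminal t h =>
      obtain ⟨v, v', rfl, h₁, h₂⟩ := ih h
      exact ⟨_, _, rfl, .terminal t h₁, h₂⟩
    | nonterminal hr h₀ h =>
      obtain ⟨v, v', rfl, h₁, h₂⟩ := ih h
      exact ⟨_, _, (List.append_assoc ..).symm, .nonterminal hr h₀ h₁, h₂⟩

theorem Der.rule {n : ℕ} {β : List (T ⊕ ℕ)} {w : List T} (hr : (n, β) ∈ G.rules)
    (h : G.Der β w) : G.Der [.inr n] w := by
  simpa using Der.nonterminal hr h .nil

theorem der_singleton_iff {n : ℕ} {w : List T} :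
    G.Der [.inr n] w ↔ ∃ β, (n, β) ∈ G.rules ∧ G.Der β w := by
  constructor
  · intro h
    obtain _ | _ | ⟨hr, h₁, h₂⟩ := h
    obtain ⟨⟩ := h₂
    exact ⟨_, hr, by simpa using h₁⟩
  · rintro ⟨β, hr, h⟩
    exact .rule hr h

/-- A symbol of a code as a symbol of the grammar it encodes. -/
abbrev toSymbol : T ⊕ ℕ → Symbol T ℕ := Sum.elim Symbol.terminal Symbol.nonterminal

theorem toSymbol_injective : Function.Injective (toSymbol (T := T)) := by
  rintro (a | a) (b | b) h <;> simp_all [toSymbol]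

theorem der_map_inl (w : List T) : G.Der (w.map .inl) w := by
  induction w with
  | nil => exact .nil
  | cons t w ih => exact .terminal t ih

theorem exists_map_toSymbol (u : List (Symbol T ℕ)) : ∃ α : List (T ⊕ ℕ), α.map toSymbol = u := by
  refine ⟨u.map fun | .terminal t => .inl t | .nonterminal n => .inr n, ?_⟩
  rw [List.map_map]
  convert List.map_id u using 2
  ext (_ | _) <;> rfl

/-- `Interp I α w`: the word `w` is obtained from the sentential form `α` by replacing each
nonterminal `n` by a word satisfying `I n`. -/
def Interp (I : ℕ → List T → Prop) : List (T ⊕ ℕ) → List T → Prop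
  | [], w => w = []
  | .inl t :: α, w => ∃ v, w = t :: v ∧ Interp I α v
  | .inr n :: α, w => ∃ u v, w = u ++ v ∧ I n u ∧ Interp I α v

/-- Derived words satisfy every family of predicates on nonterminals that respects the rules. -/
theorem Der.interp {I : ℕ → List T → Prop}
    (hI : ∀ n β w, (n, β) ∈ G.rules → Interp I β w → I n w) {α : List (T ⊕ ℕ)} {w : List T}
    (h : G.Der α w) : Interp I α w := by
  induction h with
  | nil => rfl
  | terminal t _ ih => exact ⟨_, rfl, ih⟩
  | nonterminal hr _ _ ih₁ ih₂ => exact ⟨_, _, rfl, hI _ _ _ hr ih₁, ih₂⟩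

variable [DecidableEq T]

theorem mem_toGrammar_rules {r : ContextFreeRule T ℕ} :
    r ∈ G.toGrammar.rules ↔ ∃ n β, (n, β) ∈ G.rules ∧ r = ⟨n, β.map toSymbol⟩ := by
  refine List.mem_toFinset.trans (List.mem_map.trans ?_)
  simp only [Prod.exists, eq_comm]

theorem Der.derives {α : List (T ⊕ ℕ)} {w : List T} (h : G.Der α w) :
    G.toGrammar.Derives (α.map toSymbol) (w.map Symbol.terminal) := by
  induction h with
  | nil => exact .refl _
  | terminal t _ ih => exact ih.append_left [Symbol.terminal t]
  | @nonterminal n β α v w hr _ _ ih₁ ih₂ =>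
    have hp : G.toGrammar.Produces (.nonterminal n :: α.map toSymbol)
        (β.map toSymbol ++ α.map toSymbol) :=
      ⟨_, mem_toGrammar_rules.2 ⟨n, β, hr, rfl⟩, .head _⟩
    rw [List.map_append]
    exact hp.trans_derives ((ih₁.append_right _).trans (ih₂.append_left _))

theorem Der.of_produces {α α' : List (T ⊕ ℕ)} {w : List T}
    (hp : G.toGrammar.Produces (α.map toSymbol) (α'.map toSymbol)) (h : G.Der α' w) :
    G.Der α w := by
  obtain ⟨r, hr, hp⟩ := hp
  obtain ⟨n, β, hβ, rfl⟩ := mem_toGrammar_rules.1 hr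
  obtain ⟨p, q, h₁, h₂⟩ := hp.exists_parts
  obtain ⟨α₁₂, α₃, rfl, h₁₂, h₃⟩ := List.map_eq_append_iff.1 h₁
  obtain ⟨α₁, α₂, rfl, h₁, h₂'⟩ := List.map_eq_append_iff.1 h₁₂
  have e₂ : α₂ = [.inr n] := by
    apply List.map_injective_iff.2 toSymbol_injective
    exact h₂'
  have e' : α' = α₁ ++ β ++ α₃ := by
    apply List.map_injective_iff.2 toSymbol_injective
    subst h₁ h₃
    rw [List.map_append, List.map_append]
    exact h₂
  subst e₂ e'
  obtain ⟨v, v₃, rfl, hv, hv₃⟩ := h.of_append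
  obtain ⟨v₁, v₂, rfl, hv₁, hv₂⟩ := hv.of_append
  exact (hv₁.append (.rule hβ hv₂)).append hv₃

theorem derives_iff_der {α : List (T ⊕ ℕ)} {w : List T} :
    G.toGrammar.Derives (α.map toSymbol) (w.map Symbol.terminal) ↔ G.Der α w := by
  refine ⟨fun h => ?_, Der.derives⟩
  suffices ∀ u, G.toGrammar.Derives u (w.map Symbol.terminal) →
      ∀ α : List (T ⊕ ℕ), α.map toSymbol = u → G.Der α w from this _ h _ rfl
  intro u hu
  induction hu using Relation.ReflTransGen.head_induction_on with
  | refl =>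
    intro α hα
    have : α = w.map .inl := by
      apply List.map_injective_iff.2 toSymbol_injective
      rw [hα, List.map_map]
      rfl
    exact this ▸ der_map_inl w
  | @head u v hp _ ih =>
    rintro α rfl
    obtain ⟨β, rfl⟩ := exists_map_toSymbol v
    exact .of_produces hp (ih β rfl)

theorem mem_language_iff {w : List T} : w ∈ G.toGrammar.language ↔ G.Der [.inr G.start] w :=
  derives_iff_der (α := [.inr G.start])

end GrammarCode

theorem mem_contextFreeSubset {M : Type*} [Monoid M] {k : ℕ} {b : Fin k → M}
    {G : GrammarCode (Fin k)} {m : M} :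
    m ∈ contextFreeSubset b G ↔ ∃ w, G.Der [.inr G.start] w ∧ evalWord b w = m := by
  simp only [contextFreeSubset, Set.mem_image, Set.mem_ofPred_eq, GrammarCode.mem_language_iff]

/-! ### Splitting edges into single letters -/

namespace FinAutomaton

section Split

variable {C N : Type*} [Encodable C] [Monoid N]

/-- The vertex of a split automaton at which the word `s` remains to be read before the vertex `q`
of the original automaton is reached. -/
def stateCode (s : List C) (q : ℕ) : ℕ := Encodable.encode (s, q)

theorem stateCode_inj {s s' : List C} {q q' : ℕ} :
    stateCode s q = stateCode s' q' ↔ s = s' ∧ q = q' := by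
  simp [stateCode, Encodable.encode_inj]

/-- Edges reading the letters of a word one after the other on the way to the vertex `q`. -/
def suffixEdges : List C → ℕ → List (ℕ × Option C × ℕ)
  | [], _ => []
  | c :: s, q => (stateCode (c :: s) q, some c, stateCode s q) :: suffixEdges s q

/-- The automaton in which every edge is subdivided so that each label is a letter or empty. -/
def split (P : FinAutomaton (List C)) : FinAutomaton (Option C) where
  start := stateCode ([] : List C) P.start
  terminals := P.terminals.map (stateCode ([] : List C))
  edges := P.edges.flatMap fun e =>
    (stateCode ([] : List C) e.1, none, stateCode e.2.1 e.2.2) :: suffixEdges e.2.1 e.2.2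

theorem mem_suffixEdges {s : List C} {q u v : ℕ} {o : Option C} :
    (u, o, v) ∈ suffixEdges s q ↔
      ∃ c s', c :: s' <:+ s ∧ u = stateCode (c :: s') q ∧ o = some c ∧ v = stateCode s' q := by
  induction s with
  | nil => simp [suffixEdges]
  | cons a s ih =>
    simp only [suffixEdges, List.mem_cons, ih, List.suffix_cons_iff, Prod.mk.injEq]
    constructor
    · rintro (⟨rfl, rfl, rfl⟩ | ⟨c, s', h, h'⟩)
      · exact ⟨a, s, .inl rfl, rfl, rfl, rfl⟩
      · exact ⟨c, s', .inr h, h'⟩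
    · rintro ⟨c, s', h | h, h'⟩
      · obtain ⟨rfl, rfl⟩ := List.cons.inj h
        exact .inl h'
      · exact .inr ⟨c, s', h, h'⟩

variable {P : FinAutomaton (List C)}

theorem mem_split_edges {u v : ℕ} {o : Option C} :
    (u, o, v) ∈ P.split.edges ↔ ∃ p s q, (p, s, q) ∈ P.edges ∧
      ((u = stateCode ([] : List C) p ∧ o = none ∧ v = stateCode s q) ∨
        ∃ c s', c :: s' <:+ s ∧ u = stateCode (c :: s') q ∧ o = some c ∧ v = stateCode s' q) := by
  simp only [split, List.mem_flatMap, List.mem_cons, mem_suffixEdges, Prod.mk.injEq, Prod.exists]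

theorem path_split_iff (e : C → N) {p q : ℕ} {x : N} :
    (P.split.mapLabels fun o => o.elim 1 e).Path (stateCode ([] : List C) p) x
        (stateCode ([] : List C) q) ↔
      (P.mapLabels fun s => (s.map e).prod).Path p x q := by
  constructor
  · intro h
    suffices ∀ {u v x}, (P.split.mapLabels fun o => o.elim 1 e).Path u x v →
        ∀ {s p}, u = stateCode s p → v = stateCode ([] : List C) q →
          ∃ y, x = (s.map e).prod * y ∧ (P.mapLabels fun s => (s.map e).prod).Path p y q by
      obtain ⟨y, hy, h⟩ := this h rfl rfl
      rw [hy]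
      simpa using h
    intro u v x h
    induction h with
    | nil u =>
      rintro s p rfl hv
      obtain ⟨rfl, rfl⟩ := stateCode_inj.1 hv
      exact ⟨1, by simp, .nil _⟩
    | cons he _ ih =>
      rintro s p rfl hv
      obtain ⟨o, ho, rfl⟩ := mem_mapLabels_edges.1 he
      obtain ⟨p', s', q', hP, ⟨hu, rfl, rfl⟩ | ⟨c, s'', hs, hu, rfl, rfl⟩⟩ := mem_split_edges.1 ho
      · obtain ⟨rfl, rfl⟩ := stateCode_inj.1 hu
        obtain ⟨y, rfl, hy⟩ := ih rfl hv
        exact ⟨_, by simp, .cons (mem_mapLabels_edges.2 ⟨_, hP, rfl⟩) hy⟩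
      · obtain ⟨rfl, rfl⟩ := stateCode_inj.1 hu
        obtain ⟨y, rfl, hy⟩ := ih rfl hv
        exact ⟨y, by simp [mul_assoc], hy⟩
  · intro h
    induction h with
    | nil p => exact .nil _
    | @cons p q r x y he _ ih =>
      obtain ⟨s, hs, rfl⟩ := mem_mapLabels_edges.1 he
      refine .trans ?_ ih
      have hread : ∀ s', s' <:+ s → (P.split.mapLabels fun o => o.elim 1 e).Path
          (stateCode s' q) (s'.map e).prod (stateCode ([] : List C) q) := by
        intro s' hs'
        induction s' with
        | nil => exact .nil _
        | cons c s' ih' =>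
          rw [List.map_cons, List.prod_cons]
          refine .cons (mem_mapLabels_edges.2 ⟨some c, ?_, rfl⟩)
            (ih' ((List.suffix_cons c s').trans hs'))
          exact mem_split_edges.2 ⟨p, s, q, hs, .inr ⟨c, s', hs', rfl, rfl, rfl⟩⟩
      rw [← one_mul (s.map e).prod]
      refine .cons (mem_mapLabels_edges.2 ⟨none, ?_, rfl⟩) (hread s List.suffix_rfl)
      exact mem_split_edges.2 ⟨p, s, q, hs, .inl ⟨rfl, rfl, rfl⟩⟩

end Split

end FinAutomaton

/-! ### The grammar of the paths with trivial free group component -/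

section PathGrammar

variable {X T M : Type*} [Monoid M]

/-- The right-hand side contributed by an edge label that does not involve the free group. -/
def labelBody : Option ((X × Bool) ⊕ T) → Option (List (T ⊕ ℕ))
  | none => some []
  | some (.inl _) => none
  | some (.inr t) => some [.inl t]

open Classical in
/-- Whether two labels are mutually inverse free group letters. -/
noncomputable def labelsCancel (o o' : Option ((X × Bool) ⊕ T)) : Bool :=
  decide (∃ x c, o = some (.inl (x, c)) ∧ o' = some (.inl (x, !c)))

theorem labelsCancel_iff {o o' : Option ((X × Bool) ⊕ T)} :
    labelsCancel o o' = true ↔ ∃ x c, o = some (.inl (x, c)) ∧ o' = some (.inl (x, !c)) := by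
  simp [labelsCancel]

/-- The vertices of `A` that matter for paths from the initial vertex to the vertex `f`. -/
def vertices {L : Type*} (A : FinAutomaton L) (f : ℕ) : List ℕ :=
  A.start :: f :: A.edges.flatMap fun e => [e.1, e.2.2]

/-- A grammar whose nonterminal `Nat.pair p q` derives the words that are read, in the factor `M`,
along the paths from `p` to `q` with trivial free group component. -/
noncomputable def pathGrammar (A : FinAutomaton (Option ((X × Bool) ⊕ T))) (f : ℕ) :
    GrammarCode T where
  start := Nat.pair A.start f
  rules :=
    (vertices A f).map (fun p => (Nat.pair p p, [])) ++
    ((vertices A f).flatMap fun p => (vertices A f).flatMap fun q => (vertices A f).map fun r =>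
      (Nat.pair p r, [.inr (Nat.pair p q), .inr (Nat.pair q r)])) ++
    (A.edges.filterMap fun e => (labelBody e.2.1).map fun β => (Nat.pair e.1 e.2.2, β)) ++
    (A.edges.flatMap fun e => A.edges.flatMap fun e' => bif labelsCancel e.2.1 e'.2.1 then
      [(Nat.pair e.1 e'.2.2, [.inr (Nat.pair e.2.2 e'.1)])] else [])

variable {A : FinAutomaton (Option ((X × Bool) ⊕ T))} {f : ℕ}

theorem mem_pathGrammar_rules {n : ℕ} {β : List (T ⊕ ℕ)} :
    (n, β) ∈ (pathGrammar A f).rules ↔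
      (∃ p ∈ vertices A f, n = Nat.pair p p ∧ β = []) ∨
      (∃ p ∈ vertices A f, ∃ q ∈ vertices A f, ∃ r ∈ vertices A f,
        n = Nat.pair p r ∧ β = [.inr (Nat.pair p q), .inr (Nat.pair q r)]) ∨
      (∃ p o q, (p, o, q) ∈ A.edges ∧ n = Nat.pair p q ∧ labelBody o = some β) ∨
      (∃ p x c p' q' q, (p, some (.inl (x, c)), p') ∈ A.edges ∧
        (q', some (.inl (x, !c)), q) ∈ A.edges ∧
        n = Nat.pair p q ∧ β = [.inr (Nat.pair p' q')]) := by
  simp only [pathGrammar, List.mem_append, or_assoc]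
  refine or_congr ?_ (or_congr ?_ (or_congr ?_ ?_))
  · simp [eq_comm]
  · simp [eq_comm]
  · simp only [List.mem_filterMap, Option.map_eq_some_iff, Prod.exists, Prod.mk.injEq]
    constructor
    · rintro ⟨p, o, q, h, β', hβ, rfl, rfl⟩
      exact ⟨p, o, q, h, rfl, hβ⟩
    · rintro ⟨p, o, q, h, rfl, hβ⟩
      exact ⟨p, o, q, h, β, hβ, rfl, rfl⟩
  · simp only [List.mem_flatMap, Prod.exists]
    constructor
    · rintro ⟨p, o, p', h, q', o', q, h', hm⟩
      by_cases hc : labelsCancel o o' = true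
      · rw [hc, cond_true, List.mem_singleton, Prod.mk.injEq] at hm
        obtain ⟨x, c, rfl, rfl⟩ := labelsCancel_iff.1 hc
        exact ⟨p, x, c, p', q', q, h, h', hm⟩
      · rw [Bool.eq_false_iff.2 hc] at hm
        simp at hm
    · rintro ⟨p, x, c, p', q', q, h, h', rfl, rfl⟩
      refine ⟨p, _, p', h, q', _, q, h', ?_⟩
      have hc : labelsCancel (T := T) (some (.inl (x, c))) (some (.inl (x, !c))) = true :=
        labelsCancel_iff.2 ⟨x, c, rfl, rfl⟩
      rw [hc]
      simp

theorem mem_vertices_of_edge {L : Type*} {A : FinAutomaton L} {f p q : ℕ} {o : L}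
    (h : (p, o, q) ∈ A.edges) :
    p ∈ vertices A f ∧ q ∈ vertices A f := by
  constructor <;>
    exact List.mem_cons_of_mem _ (List.mem_cons_of_mem _ (List.mem_flatMap.2 ⟨_, h, by simp⟩))

theorem evalWord_append {k : ℕ} (b : Fin k → M) (v w : List (Fin k)) :
    evalWord b (v ++ w) = evalWord b v * evalWord b w := by
  simp [evalWord]

/-- The grammar derives only labels of paths. -/
theorem path_of_der_pathGrammar {k : ℕ} (b : Fin k → M)
    {A : FinAutomaton (Option ((X × Bool) ⊕ Fin k))} {f n : ℕ} {w : List (Fin k)}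
    (h : (pathGrammar A f).Der [.inr n] w) :
    (A.mapLabels (evalLabel X b)).Path n.unpair.1 (1, evalWord b w) n.unpair.2 := by
  have key := h.interp (I := fun n w =>
    (A.mapLabels (evalLabel X b)).Path n.unpair.1 (1, evalWord b w) n.unpair.2) ?_
  · obtain ⟨u, v, rfl, hu, rfl⟩ := key
    simpa using hu
  · intro n β w hr hw
    obtain ⟨p, -, rfl, rfl⟩ | ⟨p, -, q, -, r, -, rfl, rfl⟩ | ⟨p, o, q, he, rfl, hβ⟩ |
      ⟨p, x, c, p', q', q, he, he', rfl, rfl⟩ := mem_pathGrammar_rules.1 hr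
    · obtain rfl := hw
      rw [Nat.unpair_pair]
      exact Path.nil p
    · obtain ⟨u, -, rfl, hu, v, -, rfl, hv, rfl⟩ := hw
      rw [Nat.unpair_pair] at hu hv ⊢
      simpa [evalWord_append] using hu.trans hv
    · rw [Nat.unpair_pair]
      refine .single (mem_mapLabels_edges.2 ⟨o, he, ?_⟩)
      rcases o with _ | x | t
      · obtain rfl := Option.some.inj hβ
        obtain rfl := hw
        rfl
      · simp [labelBody] at hβ
      · obtain rfl := Option.some.inj hβ
        obtain ⟨v, rfl, rfl⟩ := hw
        simp [evalLabel, evalLetter, evalWord]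
    · obtain ⟨u, -, rfl, hu, rfl⟩ := hw
      rw [Nat.unpair_pair] at hu ⊢
      have h₁ := Path.single (mem_mapLabels_edges.2 ⟨_, he, rfl⟩ :
        _ ∈ (A.mapLabels (evalLabel X b)).edges)
      have h₂ := Path.single (mem_mapLabels_edges.2 ⟨_, he', rfl⟩ :
        _ ∈ (A.mapLabels (evalLabel X b)).edges)
      have h₃ := h₁.trans (hu.trans h₂)
      have hx : (FreeGroup.mk [(x, c), (x, !c)]) = 1 :=
        Quot.sound (FreeGroup.Red.Step.not (L₁ := []))
      simpa [evalLabel, evalLetter, hx] using h₃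

/-- Membership in the context-free subset encoded by the grammar of paths. -/
theorem mem_contextFreeSubset_pathGrammar {k : ℕ} (b : Fin k → M)
    {A : FinAutomaton (Option ((X × Bool) ⊕ Fin k))} {f : ℕ} {m : M} :
    m ∈ contextFreeSubset b (pathGrammar A f) ↔
      (A.mapLabels (evalLabel X b)).Path A.start (1, m) f := by
  rw [mem_contextFreeSubset]
  constructor
  · rintro ⟨w, hw, rfl⟩
    simpa [pathGrammar] using path_of_der_pathGrammar b hw
  · intro h
    let N : ℕ → M → ℕ → Prop := fun p m q => (p = q ∧ m = 1) ∨
      (p ∈ vertices A f ∧ q ∈ vertices A f ∧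
        ∃ w, (pathGrammar A f).Der [.inr (Nat.pair p q)] w ∧ evalWord b w = m)
    have hN : N A.start m f := by
      refine rel_of_path_one b (fun p => .inl ⟨rfl, rfl⟩) ?_ ?_ ?_ ?_ h
      · rintro p q r m m' (⟨rfl, rfl⟩ | ⟨hp, hq, w, hw, rfl⟩) h'
        · simpa using h'
        obtain ⟨rfl, rfl⟩ | ⟨-, hr, v, hv, rfl⟩ := h'
        · exact .inr ⟨hp, hq, w, hw, by simp⟩
        · refine .inr ⟨hp, hr, w ++ v, ?_, evalWord_append b w v⟩
          exact .rule (mem_pathGrammar_rules.2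
            (.inr (.inl ⟨p, hp, q, hq, r, hr, rfl, rfl⟩))) (hw.append hv)
      · intro p q he
        refine .inr ⟨(mem_vertices_of_edge he).1, (mem_vertices_of_edge he).2, [], ?_, rfl⟩
        exact .rule (mem_pathGrammar_rules.2 (.inr (.inr (.inl ⟨p, _, q, he, rfl, rfl⟩)))) .nil
      · intro p q t he
        refine .inr ⟨(mem_vertices_of_edge he).1, (mem_vertices_of_edge he).2, [t], ?_,
          by simp [evalWord]⟩
        exact .rule (mem_pathGrammar_rules.2 (.inr (.inr (.inl ⟨p, _, q, he, rfl, rfl⟩))))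
          (.terminal t .nil)
      · intro p p' q' q x c m he hN he'
        refine .inr ⟨(mem_vertices_of_edge he).1, (mem_vertices_of_edge he').2, ?_⟩
        have hr : (Nat.pair p q, [.inr (Nat.pair p' q')]) ∈ (pathGrammar A f).rules :=
          mem_pathGrammar_rules.2 (.inr (.inr (.inr ⟨p, x, c, p', q', q, he, he', rfl, rfl⟩)))
        obtain ⟨rfl, rfl⟩ | ⟨-, -, w, hw, rfl⟩ := hN
        · refine ⟨[], .rule hr (.rule (mem_pathGrammar_rules.2 (.inl ?_)) .nil), rfl⟩
          exact ⟨p', (mem_vertices_of_edge he).2, rfl, rfl⟩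
        · exact ⟨w, .rule hr hw, rfl⟩
    obtain ⟨hf, rfl⟩ | ⟨-, -, hw⟩ := hN
    · refine ⟨[], .rule (mem_pathGrammar_rules.2 (.inl ?_)) .nil, rfl⟩
      exact ⟨A.start, by simp [vertices], by rw [pathGrammar, ← hf], rfl⟩
    · exact hw

end PathGrammar

/-! ### Reducing rational subsets to context-free subsets -/

section Query

variable {X M : Type*} [Monoid M] {k l : ℕ}

/-- The inverse of a free group letter; the other letters have none. -/
def invLetter {T : Type*} : (X × Bool) ⊕ T → Option ((X × Bool) ⊕ T)
  | .inl x => some (.inl (x.1, !x.2))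
  | .inr _ => none

/-- A word representing the inverse of the free group component of a word. -/
def invLetters {T : Type*} (u : List ((X × Bool) ⊕ T)) : List ((X × Bool) ⊕ T) :=
  (u.filterMap invLetter).reverse

/-- The element of `FreeGroup X × M` represented by a word in the letters. -/
def evalLetters (X : Type*) {T : Type*} (b : T → M) (u : List ((X × Bool) ⊕ T)) :
    FreeGroup X × M :=
  (u.map (evalLetter X b)).prod

theorem evalLetters_append {T : Type*} (b : T → M) (u v : List ((X × Bool) ⊕ T)) :
    evalLetters X b (u ++ v) = evalLetters X b u * evalLetters X b v := by
  simp [evalLetters]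

theorem evalLetters_invLetters {T : Type*} (b : T → M) (u : List ((X × Bool) ⊕ T)) :
    evalLetters X b (invLetters u) = ((evalLetters X b u).1⁻¹, 1) := by
  induction u with
  | nil => simp [evalLetters, invLetters, Prod.ext_iff]
  | cons c u ih =>
    rcases c with ⟨x, c⟩ | t
    · have : invLetters (.inl (x, c) :: u) =
          invLetters u ++ [(.inl (x, !c) : (X × Bool) ⊕ T)] := by
        simp [invLetters, invLetter]
      rw [this, evalLetters_append, ih]
      simp [evalLetters, evalLetter, FreeGroup.inv_mk, FreeGroup.invRev]
    · have : invLetters (.inr t :: u) = invLetters u := by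
        simp [invLetters, invLetter, List.filterMap_cons]
      rw [this, ih]
      simp [evalLetters, evalLetter]

theorem evalWord_filterMap_getRight (b : Fin k → M) (u : List ((X × Bool) ⊕ Fin k)) :
    evalWord b (u.filterMap Sum.getRight?) = (evalLetters X b u).2 := by
  induction u with
  | nil => simp [evalLetters, evalWord]
  | cons c u ih =>
    rcases c with x | t
    · simpa [evalLetters, evalLetter, List.filterMap_cons] using ih
    · rw [List.filterMap_cons_some (b := t) (by rfl)]
      simpa [evalLetters, evalLetter, evalWord] using congrArg (b t * ·) ih

/-- The automaton `P` with its labels rewritten letter by letter, followed by edges to the new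
vertex `0` that cancel the free group component of the word `w`. -/
def queryAutomaton {C : Type*} (inv : List C → List C) (γ : Fin l → List C)
    (P : FinAutomaton (List (Fin l))) (w : List (Fin l)) : FinAutomaton (List C) where
  start := P.start + 1
  terminals := []
  edges := P.edges.map (fun e => (e.1 + 1, e.2.1.flatMap γ, e.2.2 + 1)) ++
    P.terminals.map fun t => (t + 1, inv (w.flatMap γ), 0)

variable {b : Fin k → M} {a : Fin l → FreeGroup X × M} {γ : Fin l → List ((X × Bool) ⊕ Fin k)}

theorem evalLetters_flatMap (hγ : ∀ i, evalLetters X b (γ i) = a i) (w : List (Fin l)) :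
    evalLetters X b (w.flatMap γ) = evalWord a w := by
  induction w with
  | nil => rfl
  | cons i w ih => rw [List.flatMap_cons, evalLetters_append, ih, hγ]; simp [evalWord]

theorem mem_queryAutomaton_edges {C : Type*} {inv : List C → List C} {γ : Fin l → List C}
    {P : FinAutomaton (List (Fin l))} {w : List (Fin l)} {p q : ℕ} {s : List C} :
    (p, s, q) ∈ (queryAutomaton inv γ P w).edges ↔
      (∃ p' x q', (p', x, q') ∈ P.edges ∧ p = p' + 1 ∧ s = x.flatMap γ ∧ q = q' + 1) ∨
      ∃ t ∈ P.terminals, p = t + 1 ∧ s = inv (w.flatMap γ) ∧ q = 0 := by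
  simp only [queryAutomaton, List.mem_append, List.mem_map, Prod.mk.injEq, Prod.exists]
  refine or_congr ?_ ?_ <;> simp only [eq_comm]

theorem path_queryAutomaton_iff (hγ : ∀ i, evalLetters X b (γ i) = a i)
    {P : FinAutomaton (List (Fin l))} {w : List (Fin l)} :
    ((queryAutomaton invLetters γ P w).mapLabels (evalLetters X b)).Path (P.start + 1)
        (1, (evalWord a w).2) 0 ↔
      evalWord a w ∈ rationalSubset a P := by
  set Q := (queryAutomaton invLetters γ P w).mapLabels (evalLetters X b)
  have hinv : evalLetters X b (invLetters (w.flatMap γ)) = ((evalWord a w).1⁻¹, 1) := by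
    rw [evalLetters_invLetters, evalLetters_flatMap hγ]
  constructor
  · intro h
    have key : ∀ {u x v}, Q.Path u x v → ∀ {p}, u = p + 1 → v = 0 →
        ∃ y, x = y * ((evalWord a w).1⁻¹, 1) ∧
          ∃ t ∈ P.terminals, (P.mapLabels (evalWord a)).Path p y t := by
      intro u x v h
      induction h with
      | nil u => rintro p rfl h0; simp at h0
      | cons he h ih =>
        rintro p rfl hv
        obtain ⟨s, hs, rfl⟩ := mem_mapLabels_edges.1 he
        obtain ⟨p', x, q', hP, hp, rfl, rfl⟩ | ⟨t, ht, hp, rfl, rfl⟩ :=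
          mem_queryAutomaton_edges.1 hs
        · obtain rfl := Nat.succ.inj hp
          obtain ⟨y, rfl, t, ht, hy⟩ := ih rfl hv
          refine ⟨_, (mul_assoc ..).symm, t, ht, .cons (mem_mapLabels_edges.2 ⟨x, hP, ?_⟩) hy⟩
          exact (evalLetters_flatMap hγ x).symm
        · obtain rfl := Nat.succ.inj hp
          refine ⟨1, ?_, p, ht, .nil p⟩
          rw [one_mul, hinv]
          -- no edge leaves the vertex `0`, so the rest of the path is empty
          cases h with
          | nil => exact mul_one _
          | cons he' _ =>
            obtain ⟨s, hs, rfl⟩ := mem_mapLabels_edges.1 he'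
            obtain ⟨_, _, _, -, h0, -⟩ | ⟨_, -, h0, -⟩ := mem_queryAutomaton_edges.1 hs <;>
              simp at h0
    obtain ⟨y, hy, t, ht, hp⟩ := key h rfl rfl
    refine ⟨t, ht, ?_⟩
    have he : evalWord a w = y := by
      rw [Prod.ext_iff] at hy ⊢
      simp only [Prod.fst_mul, Prod.snd_mul, mul_one] at hy
      exact ⟨(mul_inv_eq_one.1 hy.1.symm).symm, hy.2⟩
    rwa [he]
  · rintro ⟨t, ht, hp⟩
    have key : ∀ {u x v}, (P.mapLabels (evalWord a)).Path u x v → Q.Path (u + 1) x (v + 1) := by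
      intro u x v h
      induction h with
      | nil u => exact .nil _
      | cons he _ ih =>
        obtain ⟨s, hs, rfl⟩ := mem_mapLabels_edges.1 he
        refine .cons (mem_mapLabels_edges.2 ⟨s.flatMap γ, ?_, evalLetters_flatMap hγ s⟩) ih
        exact mem_queryAutomaton_edges.2 (.inl ⟨_, _, _, hs, rfl, rfl, rfl⟩)
    have hlast : Q.Path (t + 1) ((evalWord a w).1⁻¹, 1) 0 :=
      .single (mem_mapLabels_edges.2
        ⟨_, mem_queryAutomaton_edges.2 (.inr ⟨t, ht, rfl, rfl, rfl⟩), hinv⟩)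
    have h := (key hp).trans hlast
    have he : evalWord a w * ((evalWord a w).1⁻¹, 1) = (1, (evalWord a w).2) := by
      ext <;> simp
    rwa [he] at h

end Query

/-! ### The pushdown automaton of a grammar, with a free group as its stack -/

section GrammarAutomaton

variable {T : Type*} [Encodable T]

/-- The vertex at which a word derived from the nonterminal `n` is about to be read. -/
def callCode (T : Type*) [Encodable T] (n : ℕ) : ℕ :=
  Encodable.encode (Sum.inl n : ℕ ⊕ List (T ⊕ ℕ))

/-- The vertex at which the suffix `α` of a right-hand side remains to be processed. The number of
this vertex also serves as a stack symbol, for the return address `α`. -/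
def suffixCode (α : List (T ⊕ ℕ)) : ℕ :=
  Encodable.encode (Sum.inr α : ℕ ⊕ List (T ⊕ ℕ))

theorem callCode_inj {n n' : ℕ} : callCode T n = callCode T n' ↔ n = n' := by
  simp [callCode]

theorem suffixCode_inj {α α' : List (T ⊕ ℕ)} : suffixCode α = suffixCode α' ↔ α = α' := by
  simp [suffixCode, Encodable.encode_inj]

theorem callCode_ne_suffixCode {n : ℕ} {α : List (T ⊕ ℕ)} : callCode T n ≠ suffixCode α := by
  rw [callCode, suffixCode, Ne, Encodable.encode_inj]
  exact Sum.inl_ne_inr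

/-- The edges processing the symbols of a right-hand side: terminals are read, and for a nonterminal
the return address is pushed before the call and popped after the return. -/
def bodyEdges : List (T ⊕ ℕ) → List (ℕ × Option ((ℕ × Bool) ⊕ T) × ℕ)
  | [] => []
  | .inl t :: α => (suffixCode (.inl t :: α), some (.inr t), suffixCode α) :: bodyEdges α
  | .inr n :: α => (suffixCode (.inr n :: α), some (.inl (suffixCode α, true)), callCode T n) ::
      (suffixCode ([] : List (T ⊕ ℕ)), some (.inl (suffixCode α, false)), suffixCode α) ::
      bodyEdges α

/-- The automaton that carries out the leftmost derivations of a grammar, using the free group on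
the return addresses as its stack. -/
def grammarAutomaton (G : GrammarCode T) : FinAutomaton (Option ((ℕ × Bool) ⊕ T)) where
  start := callCode T G.start
  terminals := [suffixCode ([] : List (T ⊕ ℕ))]
  edges := G.rules.flatMap fun r =>
    (callCode T r.1, none, suffixCode r.2) :: bodyEdges r.2

theorem mem_bodyEdges {β : List (T ⊕ ℕ)} {u v : ℕ} {o : Option ((ℕ × Bool) ⊕ T)} :
    (u, o, v) ∈ bodyEdges β ↔
      (∃ t α, .inl t :: α <:+ β ∧
        u = suffixCode (.inl t :: α) ∧ o = some (.inr t) ∧ v = suffixCode α) ∨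
      ∃ n α, .inr n :: α <:+ β ∧
        ((u = suffixCode (.inr n :: α) ∧ o = some (.inl (suffixCode α, true)) ∧ v = callCode T n) ∨
          (u = suffixCode ([] : List (T ⊕ ℕ)) ∧ o = some (.inl (suffixCode α, false)) ∧
            v = suffixCode α)) := by
  induction β with
  | nil => simp [bodyEdges]
  | cons s β ih =>
    rcases s with t | n
    · simp only [bodyEdges, List.mem_cons, Prod.mk.injEq, ih, List.suffix_cons_iff]
      constructor
      · rintro (h | ⟨t', α, h, h'⟩ | ⟨n, α, h, h'⟩)
        · exact .inl ⟨t, β, .inl rfl, h⟩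
        · exact .inl ⟨t', α, .inr h, h'⟩
        · exact .inr ⟨n, α, .inr h, h'⟩
      · rintro (⟨t', α, h | h, h'⟩ | ⟨n, α, h | h, h'⟩)
        · obtain ⟨⟨⟩, rfl⟩ := List.cons.inj h
          exact .inl h'
        · exact .inr (.inl ⟨t', α, h, h'⟩)
        · cases h
        · exact .inr (.inr ⟨n, α, h, h'⟩)
    · simp only [bodyEdges, List.mem_cons, Prod.mk.injEq, ih, List.suffix_cons_iff]
      constructor
      · rintro (h | h | ⟨t', α, h, h'⟩ | ⟨n', α, h, h'⟩)
        · exact .inr ⟨n, β, .inl rfl, .inl h⟩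
        · exact .inr ⟨n, β, .inl rfl, .inr h⟩
        · exact .inl ⟨t', α, .inr h, h'⟩
        · exact .inr ⟨n', α, .inr h, h'⟩
      · rintro (⟨t', α, h | h, h'⟩ | ⟨n, α, h | h, h' | h'⟩)
        · cases h
        · exact .inr (.inr (.inl ⟨t', α, h, h'⟩))
        · obtain ⟨⟨⟩, rfl⟩ := List.cons.inj h
          exact .inl h'
        · obtain ⟨⟨⟩, rfl⟩ := List.cons.inj h
          exact .inr (.inl h')
        · exact .inr (.inr (.inr ⟨n, α, h, .inl h'⟩))
        · exact .inr (.inr (.inr ⟨n, α, h, .inr h'⟩))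

variable {G : GrammarCode T}

theorem mem_grammarAutomaton_edges {u v : ℕ} {o : Option ((ℕ × Bool) ⊕ T)} :
    (u, o, v) ∈ (grammarAutomaton G).edges ↔ ∃ n β, (n, β) ∈ G.rules ∧
      ((u = callCode T n ∧ o = none ∧ v = suffixCode β) ∨ (u, o, v) ∈ bodyEdges β) := by
  simp only [grammarAutomaton, List.mem_flatMap, List.mem_cons, Prod.mk.injEq, Prod.exists]

theorem bodyEdges_subset {n : ℕ} {β : List (T ⊕ ℕ)} (hr : (n, β) ∈ G.rules)
    {e : ℕ × Option ((ℕ × Bool) ⊕ T) × ℕ} (he : e ∈ bodyEdges β) :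
    e ∈ (grammarAutomaton G).edges :=
  mem_grammarAutomaton_edges.2 ⟨n, β, hr, .inr he⟩

end GrammarAutomaton

section Correctness

variable {M : Type*} [Monoid M] {k : ℕ} {b : Fin k → M} {G : GrammarCode (Fin k)}

/-- Derivations are carried out by paths that leave the stack unchanged. -/
theorem path_of_der {α : List (Fin k ⊕ ℕ)} {w : List (Fin k)} (h : G.Der α w) :
    ∀ {n : ℕ} {β : List (Fin k ⊕ ℕ)}, (n, β) ∈ G.rules → α <:+ β →
      ((grammarAutomaton G).mapLabels (evalLabel ℕ b)).Path (suffixCode α) (1, evalWord b w)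
        (suffixCode ([] : List (Fin k ⊕ ℕ))) := by
  induction h with
  | nil => intro n β _ _; exact .nil _
  | @terminal t α w _ ih =>
    intro n β hr hα
    have h := Path.cons (mem_mapLabels_edges.2 ⟨some (.inr t), bodyEdges_subset hr
      (mem_bodyEdges.2 (.inl ⟨t, α, hα, rfl, rfl, rfl⟩)), rfl⟩)
      (ih hr ((List.suffix_cons _ α).trans hα))
    simpa [evalLabel, evalLetter, evalWord] using h
  | @nonterminal n' β' α v w hr' _ _ ih₁ ih₂ =>
    intro n β hr hα
    have hpush := Path.single (mem_mapLabels_edges.2 ⟨_, bodyEdges_subset hr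
      (mem_bodyEdges.2 (.inr ⟨n', α, hα, .inl ⟨rfl, rfl, rfl⟩⟩)), rfl⟩ :
        _ ∈ ((grammarAutomaton G).mapLabels (evalLabel ℕ b)).edges)
    have hcall := Path.single (mem_mapLabels_edges.2 ⟨_, mem_grammarAutomaton_edges.2
      ⟨n', β', hr', .inl ⟨rfl, rfl, rfl⟩⟩, rfl⟩ :
        _ ∈ ((grammarAutomaton G).mapLabels (evalLabel ℕ b)).edges)
    have hpop := Path.single (mem_mapLabels_edges.2 ⟨_, bodyEdges_subset hr
      (mem_bodyEdges.2 (.inr ⟨n', α, hα, .inr ⟨rfl, rfl, rfl⟩⟩)), rfl⟩ :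
        _ ∈ ((grammarAutomaton G).mapLabels (evalLabel ℕ b)).edges)
    have h := hpush.trans (hcall.trans ((ih₁ hr' List.suffix_rfl).trans
      (hpop.trans (ih₂ hr ((List.suffix_cons _ α).trans hα)))))
    have hx (i : ℕ) : FreeGroup.mk [(i, true), (i, false)] = 1 :=
      Quot.sound (FreeGroup.Red.Step.not (L₁ := []))
    simpa [evalLabel, evalLetter, hx, evalWord_append] using h

/-- The relation between vertices described by the derivations of the grammar: a step from the
suffix `γ ++ α` of a right-hand side to its suffix `α` is a derivation of a word from `γ`, and a
call may be followed by such a step. -/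
inductive DerStep (b : Fin k → M) (G : GrammarCode (Fin k)) : ℕ → M → ℕ → Prop
  | refl (p : ℕ) : DerStep b G p 1 p
  | suffix {γ α : List (Fin k ⊕ ℕ)} {w : List (Fin k)} {p : ℕ} {m : M} {q : ℕ} : G.Der γ w →
      p = suffixCode (γ ++ α) → m = evalWord b w → q = suffixCode α → DerStep b G p m q
  | call {γ α : List (Fin k ⊕ ℕ)} {w : List (Fin k)} {n p : ℕ} {m : M} {q : ℕ} : G.Der γ w →
      (n, γ ++ α) ∈ G.rules → p = callCode (Fin k) n → m = evalWord b w → q = suffixCode α →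
      DerStep b G p m q

/-- A path that leaves the stack unchanged comes from a derivation. In the free group a symbol may
also be popped before it is pushed, but then the path in between leads from a suffix `α` to a
suffix `.inr n :: α`, which is impossible because steps never lengthen the suffix. -/
theorem derStep_of_path {p q : ℕ} {m : M}
    (h : ((grammarAutomaton G).mapLabels (evalLabel ℕ b)).Path p (1, m) q) :
    DerStep b G p m q := by
  refine rel_of_path_one b .refl ?_ ?_ ?_ ?_ h
  · intro p q r m m' h h'
    cases h with
    | refl => simpa using h'
    | @suffix γ α w _ _ _ hw hp hm hq =>
      subst hp hm hq
      cases h' with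
      | refl => simpa using DerStep.suffix hw rfl rfl rfl
      | @suffix γ' α' w' _ _ _ hw' hp' hm' hq' =>
        obtain rfl := suffixCode_inj.1 hp'
        exact .suffix (hw.append hw') (by rw [List.append_assoc])
          (by rw [hm', evalWord_append]) hq'
      | call _ _ hp' => exact absurd hp'.symm callCode_ne_suffixCode
    | @call γ α w n _ _ _ hw hr hp hm hq =>
      subst hp hm hq
      cases h' with
      | refl => simpa using DerStep.call hw hr rfl rfl rfl
      | @suffix γ' α' w' _ _ _ hw' hp' hm' hq' =>
        obtain rfl := suffixCode_inj.1 hp'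
        exact .call (hw.append hw') (by rwa [List.append_assoc]) rfl
          (by rw [hm', evalWord_append]) hq'
      | call _ _ hp' => exact absurd hp'.symm callCode_ne_suffixCode
  · intro p q he
    obtain ⟨n, β, hr, ⟨rfl, -, rfl⟩ | he⟩ := mem_grammarAutomaton_edges.1 he
    · exact .call (γ := []) .nil hr rfl rfl rfl
    · obtain ⟨_, _, _, _, h, _⟩ | ⟨_, _, _, ⟨_, h, _⟩ | ⟨_, h, _⟩⟩ := mem_bodyEdges.1 he <;> cases h
  · intro p q t he
    obtain ⟨n, β, hr, ⟨rfl, h, rfl⟩ | he⟩ := mem_grammarAutomaton_edges.1 he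
    · cases h
    · obtain ⟨t, α, -, rfl, h, rfl⟩ | ⟨_, _, _, ⟨_, h, _⟩ | ⟨_, h, _⟩⟩ := mem_bodyEdges.1 he
      · cases h
        exact .suffix (γ := [.inl t]) (.terminal t .nil) rfl (by simp [evalWord]) rfl
      · cases h
      · cases h
  · intro p p' q' q x c m he hN he'
    obtain ⟨n, β, hr, ⟨-, h, -⟩ | he⟩ := mem_grammarAutomaton_edges.1 he
    · cases h
    obtain ⟨n', β', hr', ⟨-, h, -⟩ | he'⟩ := mem_grammarAutomaton_edges.1 he'
    · cases h
    obtain ⟨_, _, _, _, h, _⟩ | ⟨n, α, hα, ⟨rfl, h, rfl⟩ | ⟨rfl, h, rfl⟩⟩ := mem_bodyEdges.1 he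
    · cases h
    · cases h
      obtain ⟨_, _, _, _, h, _⟩ | ⟨n', α', -, ⟨rfl, h, rfl⟩ | ⟨rfl, h, rfl⟩⟩ := mem_bodyEdges.1 he'
      · cases h
      · simp at h
      · -- a push cancelled by a later pop: the step in between derives a word from `n`
        have hαα : α = α' := by simpa [suffixCode_inj] using h
        subst hαα
        generalize hu : callCode (Fin k) n = u at hN
        generalize hv : suffixCode ([] : List (Fin k ⊕ ℕ)) = v at hN
        cases hN with
        | refl => exact absurd (hu.trans hv.symm) callCode_ne_suffixCode
        | suffix _ hp' => exact absurd (hu.trans hp') callCode_ne_suffixCode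
        | call hw hrule hp' hm hq' =>
          obtain rfl := callCode_inj.1 (hu.trans hp')
          obtain rfl := suffixCode_inj.1 (hv.trans hq')
          rw [List.append_nil] at hrule
          exact .suffix (γ := [.inr n]) (.rule hrule hw) rfl hm rfl
    · cases h
      obtain ⟨_, _, _, _, h, _⟩ | ⟨n', α', -, ⟨rfl, h, rfl⟩ | ⟨rfl, h, rfl⟩⟩ := mem_bodyEdges.1 he'
      · cases h
      · -- a pop cancelled by a later push: the step in between would lengthen the suffix
        have hαα : α = α' := by simpa [suffixCode_inj] using h
        subst hαα
        exfalso
        generalize hu : suffixCode α = u at hN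
        generalize hv : suffixCode (.inr n' :: α) = v at hN
        cases hN with
        | refl => simpa using congrArg List.length (suffixCode_inj.1 (hu.trans hv.symm))
        | @suffix γ α' w _ _ _ hw hp' hm hq' =>
          obtain rfl := suffixCode_inj.1 (hv.trans hq')
          have := congrArg List.length (suffixCode_inj.1 (hu.trans hp'))
          simp only [List.length_append, List.length_cons] at this
          omega
        | call _ _ hp' => exact callCode_ne_suffixCode (hp'.symm.trans hu.symm)
      · simp at h

theorem path_grammarAutomaton_iff {m : M} :
    ((grammarAutomaton G).mapLabels (evalLabel ℕ b)).Path (callCode (Fin k) G.start) (1, m)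
        (suffixCode ([] : List (Fin k ⊕ ℕ))) ↔
      m ∈ contextFreeSubset b G := by
  rw [mem_contextFreeSubset]
  constructor
  · intro h
    have h := derStep_of_path h
    generalize hu : callCode (Fin k) G.start = u at h
    generalize hv : suffixCode ([] : List (Fin k ⊕ ℕ)) = v at h
    cases h with
    | refl => exact absurd (hu.trans hv.symm) callCode_ne_suffixCode
    | suffix _ hp => exact absurd (hu.trans hp) callCode_ne_suffixCode
    | @call γ α w n _ _ _ hw hr hp hm hq =>
      obtain rfl := callCode_inj.1 (hu.trans hp)
      obtain rfl := suffixCode_inj.1 (hv.trans hq)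
      rw [List.append_nil] at hr
      exact ⟨w, .rule hr hw, hm.symm⟩
  · rintro ⟨w, hw, rfl⟩
    obtain ⟨β, hr, hw⟩ := GrammarCode.der_singleton_iff.1 hw
    have hcall := Path.single (mem_mapLabels_edges.2 ⟨_, mem_grammarAutomaton_edges.2
      ⟨_, β, hr, .inl ⟨rfl, rfl, rfl⟩⟩, rfl⟩ :
        _ ∈ ((grammarAutomaton G).mapLabels (evalLabel ℕ b)).edges)
    simpa [evalLabel] using hcall.trans (path_of_der (b := b) hw hr List.suffix_rfl)

end Correctness

/-! ### Countably many free generators inside the free group of rank two -/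

section Embedding

/-- The homomorphism from the free group on `ℕ` to the free group of rank two that sends the
generator `i` to `a ^ i * b * a⁻¹ ^ i`. -/
noncomputable def freeGroupNatEmbed : FreeGroup ℕ →* FreeGroup (Fin 2) :=
  FreeGroup.lift fun i => .of 0 ^ i * .of 1 * (.of 0)⁻¹ ^ i

/-- The semidirect product of the free group on `ℤ` with `ℤ` acting by translation of the generators
contains a homomorphic image of the free group of rank two in which `a ^ i * b * a⁻¹ ^ i` becomes
the free generator `i`. -/
theorem freeGroupNatEmbed_injective : Function.Injective freeGroupNatEmbed := by
  let σ : MulAut (FreeGroup ℤ) := FreeGroup.freeGroupCongr (Equiv.addRight 1)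
  let φ : Multiplicative ℤ →* MulAut (FreeGroup ℤ) := zpowersHom _ σ
  let g : FreeGroup ℤ ⋊[φ] Multiplicative ℤ := SemidirectProduct.inr (Multiplicative.ofAdd 1)
  let ψ : FreeGroup (Fin 2) →* FreeGroup ℤ ⋊[φ] Multiplicative ℤ :=
    FreeGroup.lift ![g, SemidirectProduct.inl (.of 0)]
  have hg (z : ℤ) : g * SemidirectProduct.inl (.of z) * g⁻¹ =
      (SemidirectProduct.inl (.of (z + 1)) : FreeGroup ℤ ⋊[φ] Multiplicative ℤ) := by
    have h := SemidirectProduct.inl_aut (φ := φ) (Multiplicative.ofAdd 1) (.of z)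
    rw [map_inv] at h
    rw [← h]
    simp [φ, σ]
  have hpow (i : ℕ) : g ^ i * SemidirectProduct.inl (.of 0) * g⁻¹ ^ i =
      (SemidirectProduct.inl (.of (i : ℤ)) : FreeGroup ℤ ⋊[φ] Multiplicative ℤ) := by
    induction i with
    | zero => simp
    | succ i ih =>
      rw [pow_succ', pow_succ]
      calc _ = g * (g ^ i * SemidirectProduct.inl (.of 0) * g⁻¹ ^ i) * g⁻¹ := by
            simp only [mul_assoc]
        _ = _ := by rw [ih, hg]; push_cast; rfl
  have hcomp : ψ.comp freeGroupNatEmbed =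
      (SemidirectProduct.inl (φ := φ)).comp (FreeGroup.map (Nat.cast : ℕ → ℤ)) := by
    ext i : 1
    simpa [ψ, freeGroupNatEmbed] using hpow i
  have hinj : Function.Injective (ψ.comp freeGroupNatEmbed) := by
    rw [hcomp]
    exact SemidirectProduct.inl_injective.comp (FreeGroup.map_injective Nat.cast_injective)
  exact Function.Injective.of_comp (f := ψ) hinj

end Embedding

section Words

variable {M : Type*} [Monoid M] {l : ℕ}

theorem Generates.exists_evalWord_eq {gen : Fin l → M} (h : Generates gen) (x : M) :
    ∃ w, evalWord gen w = x := by
  have hx : x ∈ Submonoid.closure (Set.range gen) := by rw [h]; trivial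
  induction hx using Submonoid.closure_induction with
  | mem x hx => obtain ⟨i, rfl⟩ := hx; exact ⟨[i], by simp [evalWord]⟩
  | one => exact ⟨[], rfl⟩
  | mul x y _ _ hx hy =>
    obtain ⟨v, rfl⟩ := hx
    obtain ⟨w, rfl⟩ := hy
    exact ⟨v ++ w, evalWord_append gen v w⟩

/-- The word `w` repeated `i` times. -/
def wordPow {C : Type*} (w : List C) (i : ℕ) : List C := (List.range i).flatMap fun _ => w

theorem evalWord_wordPow (gen : Fin l → M) (w : List (Fin l)) (i : ℕ) :
    evalWord gen (wordPow w i) = evalWord gen w ^ i := by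
  induction i with
  | zero => simp [wordPow, evalWord]
  | succ i ih =>
    rw [wordPow, List.range_succ, List.flatMap_append, evalWord_append, pow_succ]
    exact congr_arg₂ _ ih (by simp)

/-- The word over generators of `FreeGroup (Fin 2) × M` that represents a label of the pushdown
automaton of a grammar, given words `τ t` for the terminals, `u` and `u'` for the first free
generator and its inverse, and `v true`, `v false` for the second one and its inverse. -/
def labelWord {C T : Type*} (τ : T → List C) (u u' : List C) (v : Bool → List C) :
    Option ((ℕ × Bool) ⊕ T) → List C
  | none => []
  | some (.inl x) => wordPow u x.1 ++ v x.2 ++ wordPow u' x.1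
  | some (.inr t) => τ t

variable {k : ℕ} {b : Fin k → M} {a : Fin l → FreeGroup (Fin 2) × M} {τ : Fin k → List (Fin l)}
  {u u' : List (Fin l)} {v : Bool → List (Fin l)}

theorem evalWord_flatMap_inr (hτ : ∀ t, evalWord a (τ t) = (1, b t)) (w : List (Fin k)) :
    evalWord a (w.flatMap τ) = (1, evalWord b w) := by
  induction w with
  | nil => rfl
  | cons t w ih => rw [List.flatMap_cons, evalWord_append, ih, hτ]; simp [evalWord]

theorem evalWord_labelWord (hτ : ∀ t, evalWord a (τ t) = (1, b t))
    (hu : evalWord a u = (.of 0, 1)) (hu' : evalWord a u' = ((.of 0)⁻¹, 1))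
    (hv : ∀ c, evalWord a (v c) = (FreeGroup.mk [(1, c)], 1)) (o : Option ((ℕ × Bool) ⊕ Fin k)) :
    evalWord a (labelWord τ u u' v o) =
      freeGroupNatEmbed.prodMap (MonoidHom.id M) (evalLabel ℕ b o) := by
  rcases o with _ | ⟨i, c⟩ | t
  · exact (map_one _).symm
  · simp only [labelWord, evalWord_append, evalWord_wordPow, hu, hu', hv]
    cases c
    · have h₁ : (FreeGroup.mk [(1, false)] : FreeGroup (Fin 2)) = (FreeGroup.of 1)⁻¹ := rfl
      have h₂ : (FreeGroup.mk [(i, false)] : FreeGroup ℕ) = (FreeGroup.of i)⁻¹ := rfl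
      simp [evalLabel, evalLetter, freeGroupNatEmbed, h₁, h₂, mul_assoc]
    · have h₁ : (FreeGroup.mk [(1, true)] : FreeGroup (Fin 2)) = FreeGroup.of 1 := rfl
      have h₂ : (FreeGroup.mk [(i, true)] : FreeGroup ℕ) = FreeGroup.of i := rfl
      simp [evalLabel, evalLetter, freeGroupNatEmbed, h₁, h₂]
  · simp [labelWord, hτ, evalLabel, evalLetter]

theorem mem_rationalSubset_grammarAutomaton (hτ : ∀ t, evalWord a (τ t) = (1, b t))
    (hu : evalWord a u = (.of 0, 1)) (hu' : evalWord a u' = ((.of 0)⁻¹, 1))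
    (hv : ∀ c, evalWord a (v c) = (FreeGroup.mk [(1, c)], 1)) {G : GrammarCode (Fin k)}
    {w : List (Fin k)} :
    evalWord a (w.flatMap τ) ∈
        rationalSubset a ((grammarAutomaton G).mapLabels (labelWord τ u u' v)) ↔
      evalWord b w ∈ contextFreeSubset b G := by
  have hlabels : ((grammarAutomaton G).mapLabels (labelWord τ u u' v)).mapLabels (evalWord a) =
      ((grammarAutomaton G).mapLabels (evalLabel ℕ b)).mapLabels
        (freeGroupNatEmbed.prodMap (MonoidHom.id M)) := by
    rw [mapLabels_mapLabels, mapLabels_mapLabels]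
    exact congrArg (mapLabels · _) (funext (evalWord_labelWord hτ hu hu' hv))
  rw [evalWord_flatMap_inr hτ, rationalSubset, hlabels, ← path_grammarAutomaton_iff]
  constructor
  · rintro ⟨t, ht, hp⟩
    obtain rfl := List.mem_singleton.1 ht
    obtain ⟨⟨g, m⟩, hp, hm⟩ := (path_mapLabels_hom _).1 hp
    obtain ⟨hg, rfl⟩ := Prod.ext_iff.1 hm
    obtain rfl : g = 1 := freeGroupNatEmbed_injective (hg.trans (map_one _).symm)
    exact hp
  · intro hp
    exact ⟨_, List.mem_singleton_self _, (path_mapLabels_hom _).2 ⟨_, hp, by simp⟩⟩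

end Words

/-! ### Computability of the constructions -/

section Computability

variable {α : Type*} [Primcodable α]

section Data

variable {L : Type*} [Primcodable L]

theorem FinAutomaton.primrec_start : Primrec (FinAutomaton.start (L := L)) :=
  Primrec.fst.comp (Primrec.of_equiv (e := FinAutomaton.equivTuple L))

theorem FinAutomaton.primrec_terminals : Primrec (FinAutomaton.terminals (L := L)) :=
  (Primrec.fst.comp Primrec.snd).comp (Primrec.of_equiv (e := FinAutomaton.equivTuple L))

theorem FinAutomaton.primrec_edges : Primrec (FinAutomaton.edges (L := L)) :=
  (Primrec.snd.comp Primrec.snd).comp (Primrec.of_equiv (e := FinAutomaton.equivTuple L))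

theorem FinAutomaton.primrec_mk {s : α → ℕ} {t : α → List ℕ} {e : α → List (ℕ × L × ℕ)}
    (hs : Primrec s) (ht : Primrec t) (he : Primrec e) :
    Primrec fun x => (⟨s x, t x, e x⟩ : FinAutomaton L) :=
  (Primrec.of_equiv_symm (e := FinAutomaton.equivTuple L)).comp (hs.pair (ht.pair he))

theorem GrammarCode.primrec_start : Primrec (GrammarCode.start (T := L)) :=
  Primrec.fst.comp (Primrec.of_equiv (e := GrammarCode.equivTuple L))

theorem GrammarCode.primrec_rules : Primrec (GrammarCode.rules (T := L)) :=
  Primrec.snd.comp (Primrec.of_equiv (e := GrammarCode.equivTuple L))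

theorem GrammarCode.primrec_mk {s : α → ℕ} {r : α → List (ℕ × List (L ⊕ ℕ))}
    (hs : Primrec s) (hr : Primrec r) :
    Primrec fun x => (⟨s x, r x⟩ : GrammarCode L) :=
  (Primrec.of_equiv_symm (e := GrammarCode.equivTuple L)).comp (hs.pair hr)

theorem FinAutomaton.primrec_mapLabels {L' : Type*} [Primcodable L'] {f : L → L'} (hf : Primrec f) :
    Primrec (FinAutomaton.mapLabels f) :=
  primrec_mk primrec_start primrec_terminals <| Primrec.list_map primrec_edges <|
    ((Primrec.fst.comp Primrec.snd).pair
      ((hf.comp (Primrec.fst.comp (Primrec.snd.comp Primrec.snd))).pair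
        (Primrec.snd.comp (Primrec.snd.comp Primrec.snd)))).to₂

end Data

section Split

variable {C : Type*} [Primcodable C]

theorem primrec₂_stateCode : Primrec₂ (stateCode (C := C)) :=
  Primrec.encode.comp Primrec.id

theorem primrec₂_suffixEdges : Primrec₂ (suffixEdges (C := C)) := by
  have h : Primrec fun p : List C × ℕ =>
      (List.recOn p.1 [] fun c s IH =>
        (stateCode (c :: s) p.2, some c, stateCode s p.2) :: IH : List (ℕ × Option C × ℕ)) := by
    refine Primrec.list_rec (σ := List (ℕ × Option C × ℕ)) (h := fun p x =>
      (stateCode (x.1 :: x.2.1) p.2, some x.1, stateCode x.2.1 p.2) :: x.2.2)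
      Primrec.fst (.const []) ?_
    have hq : Primrec fun y : (List C × ℕ) × C × List C × List (ℕ × Option C × ℕ) => y.1.2 :=
      Primrec.snd.comp Primrec.fst
    have hc : Primrec fun y : (List C × ℕ) × C × List C × List (ℕ × Option C × ℕ) => y.2.1 :=
      Primrec.fst.comp Primrec.snd
    have hs : Primrec fun y : (List C × ℕ) × C × List C × List (ℕ × Option C × ℕ) => y.2.2.1 :=
      Primrec.fst.comp (Primrec.snd.comp Primrec.snd)
    have hI : Primrec fun y : (List C × ℕ) × C × List C × List (ℕ × Option C × ℕ) => y.2.2.2 :=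
      Primrec.snd.comp (Primrec.snd.comp Primrec.snd)
    exact Primrec.list_cons.comp ((primrec₂_stateCode.comp (Primrec.list_cons.comp hc hs) hq).pair
      ((Primrec.option_some.comp hc).pair (primrec₂_stateCode.comp hs hq))) hI
  refine h.of_eq ?_
  rintro ⟨s, q⟩
  induction s with
  | nil => rfl
  | cons c s ih => exact congrArg _ ih

theorem primrec_split : Primrec (FinAutomaton.split (C := C)) := by
  have hst : Primrec (stateCode ([] : List C)) :=
    primrec₂_stateCode.comp (.const []) .id
  refine primrec_mk (hst.comp primrec_start) (Primrec.list_map primrec_terminals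
    (hst.comp Primrec.snd).to₂) (Primrec.list_flatMap primrec_edges ?_)
  have hp : Primrec fun y : FinAutomaton (List C) × ℕ × List C × ℕ => y.2.1 :=
    Primrec.fst.comp Primrec.snd
  have hs : Primrec fun y : FinAutomaton (List C) × ℕ × List C × ℕ => y.2.2.1 :=
    Primrec.fst.comp (Primrec.snd.comp Primrec.snd)
  have hq : Primrec fun y : FinAutomaton (List C) × ℕ × List C × ℕ => y.2.2.2 :=
    Primrec.snd.comp (Primrec.snd.comp Primrec.snd)
  exact Primrec.list_cons.comp ((hst.comp hp).pair ((Primrec.const none).pair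
    (primrec₂_stateCode.comp hs hq))) (primrec₂_suffixEdges.comp hs hq)

end Split

section PathGrammar

variable {X T : Type*} [Finite X] [Finite T] [Primcodable X] [Primcodable T]

theorem primrec_vertices {L : Type*} [Primcodable L] (f : ℕ) :
    Primrec fun A : FinAutomaton L => vertices A f := by
  refine Primrec.list_cons.comp primrec_start (Primrec.list_cons.comp (.const f)
    (Primrec.list_flatMap primrec_edges ?_))
  exact Primrec.list_cons.comp (Primrec.fst.comp Primrec.snd) (Primrec.list_cons.comp
    (Primrec.snd.comp (Primrec.snd.comp Primrec.snd)) (.const []))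

theorem primrec_pathGrammar (f : ℕ) :
    Primrec fun A : FinAutomaton (Option ((X × Bool) ⊕ T)) => pathGrammar A f := by
  have hV := primrec_vertices (L := Option ((X × Bool) ⊕ T)) f
  refine GrammarCode.primrec_mk (Primrec₂.natPair.comp primrec_start (.const f)) ?_
  refine Primrec.list_append.comp (Primrec.list_append.comp (Primrec.list_append.comp ?_ ?_) ?_) ?_
  · exact Primrec.list_map hV
      ((Primrec₂.natPair.comp Primrec.snd Primrec.snd).pair (.const [])).to₂
  · refine Primrec.list_flatMap hV ?_
    refine Primrec.list_flatMap (hV.comp Primrec.fst) ?_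
    refine Primrec.list_map (hV.comp (Primrec.fst.comp Primrec.fst)) ?_
    have hr := Primrec.snd (α := (FinAutomaton (Option ((X × Bool) ⊕ T)) × ℕ) × ℕ) (β := ℕ)
    have hq := Primrec.snd.comp
      (Primrec.fst (α := (FinAutomaton (Option ((X × Bool) ⊕ T)) × ℕ) × ℕ) (β := ℕ))
    have hp := (Primrec.snd.comp Primrec.fst).comp
      (Primrec.fst (α := (FinAutomaton (Option ((X × Bool) ⊕ T)) × ℕ) × ℕ) (β := ℕ))
    exact (Primrec₂.natPair.comp hp hr).pair (Primrec.list_cons.comp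
      (Primrec.sumInr.comp (Primrec₂.natPair.comp hp hq)) (Primrec.list_cons.comp
        (Primrec.sumInr.comp (Primrec₂.natPair.comp hq hr)) (.const [])))
  · refine Primrec.listFilterMap primrec_edges ?_
    refine Primrec.option_map ((Primrec.dom_finite labelBody).comp
      (Primrec.fst.comp (Primrec.snd.comp Primrec.snd))) ?_
    exact (Primrec₂.natPair.comp (Primrec.fst.comp (Primrec.snd.comp Primrec.fst))
      (Primrec.snd.comp (Primrec.snd.comp (Primrec.snd.comp Primrec.fst)))).pair Primrec.snd
  · refine Primrec.list_flatMap primrec_edges ?_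
    refine Primrec.list_flatMap (primrec_edges.comp Primrec.fst) ?_
    let A := FinAutomaton (Option ((X × Bool) ⊕ T))
    let E := ℕ × Option ((X × Bool) ⊕ T) × ℕ
    have he : Primrec fun y : (A × E) × E => y.1.2 := Primrec.snd.comp Primrec.fst
    have he' : Primrec fun y : (A × E) × E => y.2 := Primrec.snd
    have hc : Primrec fun y : (A × E) × E => labelsCancel y.1.2.2.1 y.2.2.1 :=
      (Primrec.dom_finite fun o : Option ((X × Bool) ⊕ T) × Option ((X × Bool) ⊕ T) =>
        labelsCancel o.1 o.2).comp ((Primrec.fst.comp (Primrec.snd.comp he)).pair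
          (Primrec.fst.comp (Primrec.snd.comp he')))
    have hrule : Primrec fun y : (A × E) × E => ((Nat.pair y.1.2.1 y.2.2.2,
        [.inr (Nat.pair y.1.2.2.2 y.2.1)]) : ℕ × List (T ⊕ ℕ)) :=
      (Primrec₂.natPair.comp (Primrec.fst.comp he) (Primrec.snd.comp (Primrec.snd.comp he'))).pair
        (Primrec.list_cons.comp (Primrec.sumInr.comp (Primrec₂.natPair.comp
          (Primrec.snd.comp (Primrec.snd.comp he)) (Primrec.fst.comp he'))) (.const []))
    exact Primrec.cond hc (Primrec.list_cons.comp hrule (.const [])) (.const [])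

theorem primrec_invLetters : Primrec (invLetters (X := X) (T := T)) :=
  Primrec.list_reverse.comp (Primrec.listFilterMap .id
    ((Primrec.dom_finite invLetter).comp Primrec.snd).to₂)

end PathGrammar

theorem primrec_flatMap_fin {l : ℕ} {C : Type*} [Primcodable C] (γ : Fin l → List C) :
    Primrec fun w : List (Fin l) => w.flatMap γ :=
  Primrec.list_flatMap .id ((Primrec.dom_finite γ).comp Primrec.snd).to₂

theorem primrec_queryAutomaton {l : ℕ} {C : Type*} [Primcodable C] {inv : List C → List C}
    (hinv : Primrec inv) (γ : Fin l → List C) :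
    Primrec₂ (queryAutomaton inv γ) := by
  have hγ := primrec_flatMap_fin γ
  refine primrec_mk (Primrec.succ.comp (primrec_start.comp Primrec.fst)) (.const [])
    (Primrec.list_append.comp (Primrec.list_map (primrec_edges.comp Primrec.fst) ?_)
      (Primrec.list_map (primrec_terminals.comp Primrec.fst) ?_))
  · exact ((Primrec.succ.comp (Primrec.fst.comp Primrec.snd)).pair
      ((hγ.comp (Primrec.fst.comp (Primrec.snd.comp Primrec.snd))).pair
        (Primrec.succ.comp (Primrec.snd.comp (Primrec.snd.comp Primrec.snd))))).to₂
  · exact ((Primrec.succ.comp Primrec.snd).pair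
      ((hinv.comp (hγ.comp (Primrec.snd.comp Primrec.fst))).pair (.const 0))).to₂

section GrammarAutomaton

variable {T : Type*} [Primcodable T]

theorem primrec_callCode : Primrec (callCode T) :=
  Primrec.encode.comp Primrec.sumInl

theorem primrec_suffixCode : Primrec (suffixCode (T := T)) :=
  Primrec.encode.comp Primrec.sumInr

theorem primrec_bodyEdges : Primrec (bodyEdges (T := T)) := by
  let E := ℕ × Option ((ℕ × Bool) ⊕ T) × ℕ
  let Y := List (T ⊕ ℕ) × (T ⊕ ℕ) × List (T ⊕ ℕ) × List E
  have hα : Primrec fun y : Y => y.2.2.1 := Primrec.fst.comp (Primrec.snd.comp Primrec.snd)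
  have hI : Primrec fun y : Y => y.2.2.2 := Primrec.snd.comp (Primrec.snd.comp Primrec.snd)
  have hs : Primrec fun y : Y => y.2.1 := Primrec.fst.comp Primrec.snd
  have hsα : Primrec fun y : Y => suffixCode (y.2.1 :: y.2.2.1) :=
    primrec_suffixCode.comp (Primrec.list_cons.comp hs hα)
  have hcα : Primrec fun y : Y => suffixCode y.2.2.1 := primrec_suffixCode.comp hα
  have hletter (c : Bool) : Primrec fun y : Y × ℕ =>
      (some (.inl (suffixCode y.1.2.2.1, c)) : Option ((ℕ × Bool) ⊕ T)) :=
    Primrec.option_some.comp (Primrec.sumInl.comp ((hcα.comp Primrec.fst).pair (.const c)))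
  have hstep : Primrec fun y : Y => (Sum.casesOn y.2.1
      (fun t => (suffixCode (y.2.1 :: y.2.2.1), some (.inr t), suffixCode y.2.2.1) :: y.2.2.2)
      (fun n => (suffixCode (y.2.1 :: y.2.2.1), some (.inl (suffixCode y.2.2.1, true)),
          callCode T n) ::
        (suffixCode ([] : List (T ⊕ ℕ)), some (.inl (suffixCode y.2.2.1, false)),
          suffixCode y.2.2.1) :: y.2.2.2) : List E) := by
    refine Primrec.sumCasesOn hs ?_ ?_
    · exact Primrec.list_cons.comp ((hsα.comp Primrec.fst).pair
        ((Primrec.option_some.comp (Primrec.sumInr.comp Primrec.snd)).pair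
          (hcα.comp Primrec.fst))) (hI.comp Primrec.fst)
    · exact Primrec.list_cons.comp ((hsα.comp Primrec.fst).pair
        ((hletter true).pair (primrec_callCode.comp Primrec.snd)))
        (Primrec.list_cons.comp ((Primrec.const _).pair
          ((hletter false).pair (hcα.comp Primrec.fst))) (hI.comp Primrec.fst))
  have h := Primrec.list_rec (σ := List E) (Primrec.id (α := List (T ⊕ ℕ))) (.const []) hstep.to₂
  refine h.of_eq fun β => ?_
  induction β with
  | nil => rfl
  | cons s β ih =>
    rcases s with t | n
    · exact congrArg _ ih
    · exact congrArg (fun x => _ :: _ :: x) ih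

theorem primrec_grammarAutomaton : Primrec (grammarAutomaton (T := T)) := by
  refine primrec_mk (primrec_callCode.comp GrammarCode.primrec_start) (.const _)
    (Primrec.list_flatMap GrammarCode.primrec_rules ?_)
  exact Primrec.list_cons.comp ((primrec_callCode.comp (Primrec.fst.comp Primrec.snd)).pair
    ((Primrec.const none).pair (primrec_suffixCode.comp (Primrec.snd.comp Primrec.snd))))
    (primrec_bodyEdges.comp (Primrec.snd.comp Primrec.snd))

theorem primrec_labelWord [Finite T] {C : Type*} [Primcodable C] (τ : T → List C)
    (u u' : List C) (v : Bool → List C) : Primrec (labelWord τ u u' v) := by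
  have hpow (w : List C) : Primrec (wordPow w) :=
    Primrec.list_flatMap Primrec.list_range (Primrec.const w).to₂
  have h : Primrec fun o : Option ((ℕ × Bool) ⊕ T) => (Option.casesOn o [] fun s =>
      Sum.casesOn s (fun x => wordPow u x.1 ++ v x.2 ++ wordPow u' x.1) τ : List C) := by
    refine Primrec.option_casesOn .id (.const []) ?_
    refine Primrec.sumCasesOn Primrec.snd ?_ ((Primrec.dom_finite τ).comp Primrec.snd)
    exact (Primrec.list_append.comp (Primrec.list_append.comp
      ((hpow u).comp (Primrec.fst.comp Primrec.snd))
      ((Primrec.dom_finite v).comp (Primrec.snd.comp Primrec.snd)))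
      ((hpow u').comp (Primrec.fst.comp Primrec.snd)))
  refine h.of_eq ?_
  rintro (_ | x | t) <;> rfl

end GrammarAutomaton

end Computability

/-! ### Equivalence of the decision problems -/

section Reductions

variable {M : Type*} [Monoid M] {k l : ℕ} {b : Fin k → M}

/-- Each element of `FreeGroup X × M` is represented by a word in the letters of the two factors. -/
theorem exists_evalLetters_eq (hb : Generates b) {X : Type*} (x : FreeGroup X × M) :
    ∃ u, evalLetters X b u = x := by
  obtain ⟨L, hL⟩ := Quot.exists_rep x.1
  obtain ⟨w, hw⟩ := hb.exists_evalWord_eq x.2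
  have h₁ : ∀ L : List (X × Bool), evalLetters X b (L.map .inl) = (FreeGroup.mk L, 1) := by
    intro L
    induction L with
    | nil => rfl
    | cons x L ih =>
      have h : evalLetters X b ((x :: L).map .inl) =
          (FreeGroup.mk [x], 1) * evalLetters X b (L.map .inl) := List.prod_cons
      rw [h, ih]
      exact Prod.ext rfl (one_mul 1)
  have h₂ : ∀ w : List (Fin k), evalLetters X b (w.map .inr) = (1, evalWord b w) := by
    intro w
    induction w with
    | nil => rfl
    | cons t w ih =>
      have h : evalLetters X b ((t :: w).map .inr) =
          (1, b t) * evalLetters X b (w.map .inr) := List.prod_cons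
      rw [h, ih]
      exact Prod.ext (one_mul 1) List.prod_cons.symm
  refine ⟨L.map .inl ++ w.map .inr, ?_⟩
  rw [evalLetters_append, h₁, h₂, hw]
  exact Prod.ext ((mul_one _).trans hL) (one_mul _)

theorem rationalSubsetProblemDecidable_of_contextFree (hb : Generates b) {n : ℕ}
    (a : Fin l → FreeGroup (Fin n) × M) (h : ContextFreeMembershipDecidable b) :
    RationalSubsetProblemDecidable a := by
  choose γ hγ using fun i => exists_evalLetters_eq hb (a i)
  refine ComputablePred.computable_of_manyOneReducible ⟨fun p =>
    (pathGrammar (queryAutomaton invLetters γ p.1 p.2).split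
        (stateCode ([] : List ((Fin n × Bool) ⊕ Fin k)) 0),
      (p.2.flatMap γ).filterMap Sum.getRight?), Primrec.to_comp ?_, fun p => ?_⟩ h
  · exact ((primrec_pathGrammar _).comp (primrec_split.comp
      (primrec_queryAutomaton primrec_invLetters γ))).pair
        (Primrec.listFilterMap ((primrec_flatMap_fin γ).comp Primrec.snd)
          ((Primrec.dom_finite Sum.getRight?).comp Primrec.snd).to₂)
  · beta_reduce
    rw [← path_queryAutomaton_iff hγ, mem_contextFreeSubset_pathGrammar,
      evalWord_filterMap_getRight, evalLetters_flatMap hγ]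
    exact (path_split_iff (evalLetter (Fin n) b)).symm

theorem contextFreeMembershipDecidable_of_rational {a : Fin l → FreeGroup (Fin 2) × M}
    (ha : Generates a) (h : RationalSubsetProblemDecidable a) :
    ContextFreeMembershipDecidable b := by
  choose τ hτ using fun t => ha.exists_evalWord_eq (1, b t)
  obtain ⟨u, hu⟩ := ha.exists_evalWord_eq (.of 0, 1)
  obtain ⟨u', hu'⟩ := ha.exists_evalWord_eq ((.of 0)⁻¹, 1)
  choose v hv using fun c : Bool => ha.exists_evalWord_eq (FreeGroup.mk [(1, c)], 1)
  refine ComputablePred.computable_of_manyOneReducible ⟨fun p =>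
    ((grammarAutomaton p.1).mapLabels (labelWord τ u u' v), p.2.flatMap τ), Primrec.to_comp ?_,
      fun p => (mem_rationalSubset_grammarAutomaton hτ hu hu' hv).symm⟩ h
  exact ((primrec_mapLabels (primrec_labelWord τ u u' v)).comp
    (primrec_grammarAutomaton.comp Primrec.fst)).pair
      ((primrec_flatMap_fin τ).comp Primrec.snd)

end Reductions

end RatCF

theorem mainTheorem10 {M : Type*} [Monoid M]
    {k : ℕ} (b : Fin k → M) (hb : RatCF.Generates b)
    {l : ℕ → ℕ} (a : (n : ℕ) → Fin (l n) → FreeGroup (Fin n) × M)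
    (ha : ∀ n, RatCF.Generates (a n)) :
    List.TFAE
      [RatCF.RationalSubsetProblemDecidable (a 2),
       ∀ n : ℕ, RatCF.RationalSubsetProblemDecidable (a n),
       RatCF.ContextFreeMembershipDecidable b] := by
  tfae_have 1 → 3 := RatCF.contextFreeMembershipDecidable_of_rational (ha 2)
  tfae_have 3 → 2 := fun h n => RatCF.rationalSubsetProblemDecidable_of_contextFree hb (a n) h
  tfae_have 2 → 1 := fun h => h 2
  tfae_finish
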